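/- Let $q$ be a prime power, let $V$ be a vector space of finite dimension $n$ over the finite field $\mathbb{F}_q$, and let $\mathrm{Bil}(V)$ be the $\mathbb{F}_q$-vector space of all bilinear forms $f : V\times V\to \mathbb{F}_q$. For $f\in \mathrm{Bil}(V)$ define the rank of $f$ by $\operatorname{rank} f=\dim V-\dim\{u\in V : f(u,w)=0 \text{ for all } w\in V\}$. Let $r$ be an integer with $0<r<n$ and suppose that $q\geq r+1$. Let $\mathcal{M}$ be a subspace of $\mathrm{Bil}(V)$ of dimension $2n$ such that every non-zero element of $\mathcal{M}$ has rank $r$ or $n$. Then $n-r$ divides $n$, and the number of elements of rank $r$ in $\mathcal{M}$ is \[ \frac{(q^n-1)^2}{q^{n-r}-1}. \] -/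

import Mathlib

/-- The left radical `{u | ∀ w, f u w = 0}` of a bilinear form `f` on `V × V`. -/
def radL {F V : Type*} [Field F] [AddCommGroup V] [Module F V]
    (f : LinearMap.BilinForm F V) : Submodule F V where
  carrier := {u | ∀ w, f u w = 0}
  add_mem' := by
    intro a b ha hb w
    simp [ha w, hb w]
  zero_mem' := by
    intro w
    simp
  smul_mem' := by
    intro c a ha w
    simp [ha w]

/-- The rank `dim V - dim rad_L f` of a bilinear form on a finite-dimensional space
(the natural-number subtraction never truncates there). -/
noncomputable def bilRank {F V : Type*} [Field F] [AddCommGroup V] [Module F V]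
    (f : LinearMap.BilinForm F V) : ℕ :=
  Module.finrank F V - Module.finrank F (radL f)

/-! For `u ≠ 0` let `M_u` be the forms in `M` killing `u`. Evaluation at `u` lands in the
`n`-dimensional dual, so `dim M_u ≥ n`; non-zero elements of `M_u` are degenerate, hence of rank
`r`, and `finrank_le_of_constant_bilRank` gives `dim M_u ≤ n`. Counting pairs `(u, f)` with `f u =
0` then yields `(q^n - 1)^2 = N (q^(n-r) - 1)`, where `N` is the number of rank-`r` forms, and
`dvd_of_pow_sub_one_dvd_sq` extracts the divisibility. -/

open Polynomial in
/-- If every `x • f + g` has rank at most `rank f` and the field has more than `rank f` elements,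
then `g` maps the kernel of `f` into the range of `f`. -/
theorem apply_mem_range_of_finrank_range_le {F V W : Type*} [Field F] [Finite F]
    [AddCommGroup V] [Module F V] [AddCommGroup W] [Module F W] [FiniteDimensional F W]
    {r : ℕ} (hr : r + 1 ≤ Nat.card F) (f g : V →ₗ[F] W)
    (hf : Module.finrank F (LinearMap.range f) = r)
    (hfg : ∀ x : F, Module.finrank F (LinearMap.range (x • f + g)) ≤ r)
    {u : V} (hu : f u = 0) : g u ∈ LinearMap.range f := by
  classical
  have := Fintype.ofFinite F
  by_contra hgu
  let b := Module.finBasisOfFinrankEq F (LinearMap.range f) hf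
  choose v hv using fun i => (b i).2
  let y : Option (Fin r) → W := fun o => o.elim (g u) fun i => f (v i)
  have hbspan : Submodule.span F (Set.range fun i => f (v i)) ≤ LinearMap.range f := by
    rw [Submodule.span_le]
    rintro _ ⟨i, rfl⟩
    exact ⟨v i, rfl⟩
  have hblin : LinearIndependent F fun i => f (v i) := by
    have := b.linearIndependent.map' (LinearMap.range f).subtype (Submodule.ker_subtype _)
    rwa [show (fun i => f (v i)) = (LinearMap.range f).subtype ∘ b from funext hv]
  have hy : LinearIndependent F y :=
    linearIndependent_option.2 ⟨hblin, fun h => hgu (hbspan h)⟩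
  obtain ⟨L, hL⟩ : ∃ L : Option (Fin r) → W →ₗ[F] F,
      ∀ i j, L j (y i) = (1 : Matrix (Option (Fin r)) (Option (Fin r)) F) i j := by
    have hrep : ∀ j, ∃ l : W →ₗ[F] F, l ∘ₗ (Submodule.span F (Set.range y)).subtype =
        Finsupp.lapply j ∘ₗ hy.repr := fun j => LinearMap.exists_extend _
    choose L hL using hrep
    refine ⟨L, fun i j => ?_⟩
    have hi : y i ∈ Submodule.span F (Set.range y) := Submodule.subset_span ⟨i, rfl⟩
    have h1 : L j (y i) = hy.repr ⟨y i, hi⟩ j := LinearMap.congr_fun (hL j) ⟨y i, hi⟩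
    rw [h1, hy.repr_eq_single i ⟨y i, hi⟩ rfl, Matrix.one_apply, Finsupp.single_apply]
  let v' : Option (Fin r) → V := fun o => o.elim u v
  let B : Matrix (Option (Fin r)) (Option (Fin r)) F :=
    Matrix.of fun i j => i.elim 0 fun k => L j (g (v k))
  let N : Matrix (Option (Fin r)) (Option (Fin r)) F[X] :=
    Matrix.of fun i j => X * C (L j (f (v' i))) + C (L j (g (v' i)))
  let Q : F[X] := Matrix.det ((X : F[X]) • (1 : Matrix _ _ F).map C + B.map C)
  -- Since `f u = 0`, row `none` of `N` is the constant unit vector; scaling it by `X` turns `N`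
  -- into `X • 1 + B`. So `N.det` has degree `r`, yet it vanishes at all `q > r` field elements.
  have hQ : Q = X * N.det := by
    rw [← N.updateRow_eq_self none, ← Matrix.det_updateRow_smul]
    refine congrArg Matrix.det (Matrix.ext fun i j => ?_)
    rw [Matrix.add_apply, Matrix.smul_apply, Matrix.map_apply, Matrix.map_apply, ← hL i j,
      smul_eq_mul]
    rcases i with _ | i <;> simp [N, B, v', y, hu]
  have hQdeg : Q.natDegree ≤ r + 1 := by
    simpa [-Matrix.map_one] using natDegree_det_X_add_C_le (1 : Matrix _ _ F) B
  have hQcoeff : Q.coeff (r + 1) = 1 := by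
    simpa [-Matrix.map_one] using coeff_det_X_add_C_card (1 : Matrix (Option (Fin r)) _ F) B
  have hP0 : N.det ≠ 0 := by
    intro h
    rw [hQ, h] at hQcoeff
    simp at hQcoeff
  refine hP0 (eq_zero_of_natDegree_lt_card_of_eval_eq_zero _ Function.injective_id (fun x => ?_) ?_)
  · rw [id, ← coe_evalRingHom, RingHom.map_det, ← Matrix.exists_vecMul_eq_zero_iff]
    have hdep : ¬ LinearIndependent F fun i => (x • f + g) (v' i) := by
      intro h
      have h2 : LinearIndependent F fun i => (x • f + g).rangeRestrict (v' i) :=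
        LinearIndependent.of_comp (LinearMap.range (x • f + g)).subtype h
      have := h2.fintype_card_le_finrank
      have := hfg x
      simp at *
      omega
    obtain ⟨c, hc, i, hi⟩ := Fintype.not_linearIndependent_iff.1 hdep
    refine ⟨c, fun h => hi (congrFun h i), ?_⟩
    ext j
    have := congrArg (L j) hc
    rw [map_sum, map_zero] at this
    simp only [Pi.zero_apply]
    rw [← this]
    simp only [Matrix.vecMul, dotProduct]
    refine Finset.sum_congr rfl fun i _ => ?_
    simp [N]
    ring
  · rw [hQ, natDegree_X_mul hP0] at hQdeg
    rw [← Nat.card_eq_fintype_card]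
    omega

theorem radL_eq_ker {F V : Type*} [Field F] [AddCommGroup V] [Module F V]
    (f : LinearMap.BilinForm F V) : radL f = LinearMap.ker f := by
  ext u
  rw [LinearMap.mem_ker, LinearMap.ext_iff]
  rfl

section
variable {F V : Type*} [Field F] [AddCommGroup V] [Module F V]

theorem bilRank_eq_finrank_range [FiniteDimensional F V] (f : LinearMap.BilinForm F V) :
    bilRank f = Module.finrank F (LinearMap.range f) := by
  rw [bilRank, radL_eq_ker, ← LinearMap.finrank_range_add_finrank_ker f]
  omega

theorem bilRank_add_finrank_ker [FiniteDimensional F V] (f : LinearMap.BilinForm F V) :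
    bilRank f + Module.finrank F (LinearMap.ker f) = Module.finrank F V := by
  rw [bilRank_eq_finrank_range, LinearMap.finrank_range_add_finrank_ker f]

/-- The forms in `K` having `u` in their left radical. -/
def formsKilling (K : Submodule F (LinearMap.BilinForm F V)) (u : V) :
    Submodule F (LinearMap.BilinForm F V) :=
  K ⊓ LinearMap.ker (LinearMap.applyₗ u)

theorem mem_formsKilling {K : Submodule F (LinearMap.BilinForm F V)} {u : V}
    {f : LinearMap.BilinForm F V} : f ∈ formsKilling K u ↔ f ∈ K ∧ f u = 0 :=
  Iff.rfl

theorem finrank_le_finrank_inf_ker_add {E X : Type*} [AddCommMonoid E] [Module F E]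
    [Module.Finite F E] [AddCommMonoid X] [Module F X] [Module.Finite F X]
    (K : Submodule F E) (T : E →ₗ[F] X) (S : Submodule F X) (hS : ∀ f ∈ K, T f ∈ S) :
    Module.finrank F K ≤ Module.finrank F ↥(K ⊓ LinearMap.ker T) + Module.finrank F S := by
  let := Module.addCommMonoidToAddCommGroup F (M := E)
  let := Module.addCommMonoidToAddCommGroup F (M := X)
  let e : K →ₗ[F] X := T ∘ₗ K.subtype
  have hk : (LinearMap.ker e).map K.subtype = K ⊓ LinearMap.ker T := by
    rw [LinearMap.ker_comp, Submodule.map_comap_subtype]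
  have h1 : Module.finrank F (LinearMap.ker e) = Module.finrank F ↥(K ⊓ LinearMap.ker T) := by
    rw [← hk]
    exact (LinearEquiv.finrank_eq
      (Submodule.equivMapOfInjective _ K.injective_subtype _))
  have h2 : Module.finrank F (LinearMap.range e) ≤ Module.finrank F S := by
    apply Submodule.finrank_mono
    rintro _ ⟨f, rfl⟩
    exact hS f f.2
  have := LinearMap.finrank_range_add_finrank_ker e
  omega

theorem finrank_le_finrank_formsKilling_add [FiniteDimensional F V]
    (K : Submodule F (LinearMap.BilinForm F V)) (u : V) (S : Submodule F (V →ₗ[F] F))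
    (hS : ∀ f ∈ K, f u ∈ S) :
    Module.finrank F K ≤ Module.finrank F (formsKilling K u) + Module.finrank F S :=
  finrank_le_finrank_inf_ker_add K (LinearMap.applyₗ u) S hS

theorem card_filter_mem_ne_zero {W : Type*} [AddCommMonoid W] [Module F W] [Finite F] [Fintype W]
    (K : Submodule F W) [DecidablePred fun f : W => f ≠ 0 ∧ f ∈ K] :
    ((Finset.univ.filter fun f : W => f ≠ 0 ∧ f ∈ K).card : ℤ) =
      (Nat.card F : ℤ) ^ Module.finrank F K - 1 := by
  classical
  let := Module.addCommMonoidToAddCommGroup F (M := W)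
  have h1 : (Finset.univ.filter fun f : W => f ≠ 0 ∧ f ∈ K) =
      (Finset.univ.filter fun f : W => f ∈ K).erase 0 := by
    ext; simp
  have h2 : (Finset.univ.filter fun f : W => f ∈ K).card = Nat.card F ^ Module.finrank F K := by
    rw [← Module.natCard_eq_pow_finrank (K := F) (V := K), Nat.card_eq_fintype_card,
      Fintype.card_subtype]
  have h3 : (0 : W) ∈ Finset.univ.filter fun f : W => f ∈ K := by simp
  have := Finset.card_erase_add_one h3
  rw [h1, ← Nat.cast_pow, ← h2, ← this]
  simp

open Classical in
/-- Double count of the pairs `(u, f)`, both non-zero, with `f ∈ K` and `u` in the left radical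
of `f`. -/
theorem sum_card_formsKilling_eq_sum_card_ker [Finite F] [Fintype V]
    [Fintype (LinearMap.BilinForm F V)] (K : Submodule F (LinearMap.BilinForm F V)) :
    ∑ u : V with u ≠ 0, ((Nat.card F : ℤ) ^ Module.finrank F (formsKilling K u) - 1) =
      ∑ f : LinearMap.BilinForm F V with f ≠ 0 ∧ f ∈ K,
        ((Nat.card F : ℤ) ^ Module.finrank F (LinearMap.ker f) - 1) := by
  have := Finset.sum_card_bipartiteAbove_eq_sum_card_bipartiteBelow
    (s := Finset.univ.filter fun u : V => u ≠ 0)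
    (t := Finset.univ.filter fun f : LinearMap.BilinForm F V => f ≠ 0 ∧ f ∈ K)
    fun u f => f u = 0
  have := congrArg (Nat.cast : ℕ → ℤ) this
  push_cast at this
  convert this using 2 with u hu f hf
  · rw [← card_filter_mem_ne_zero, Finset.bipartiteAbove, Finset.filter_filter]
    congr 2
    ext
    simp [mem_formsKilling, and_assoc]
  · rw [← card_filter_mem_ne_zero, Finset.bipartiteBelow, Finset.filter_filter]
    simp only [LinearMap.mem_ker]

/-- If `d = dim K > n`, every `u` is killed by some non-zero `f ∈ K`. Then all `g u` lie in the
`r`-dimensional range of `f`, so `dim K_u ≥ d - r`, too large for the double count. -/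
theorem finrank_le_of_constant_bilRank [Finite F] [FiniteDimensional F V] {r : ℕ} (hr0 : 0 < r)
    (hqr : r + 1 ≤ Nat.card F) (K : Submodule F (LinearMap.BilinForm F V))
    (hK : ∀ f ∈ K, f ≠ 0 → bilRank f = r) : Module.finrank F K ≤ Module.finrank F V := by
  classical
  have : Finite V := Module.finite_of_finite F
  have : Finite (LinearMap.BilinForm F V) := Module.finite_of_finite F
  have := Fintype.ofFinite V
  have := Fintype.ofFinite (LinearMap.BilinForm F V)
  by_contra! hlt
  set d := Module.finrank F K with hd
  set n := Module.finrank F V with hn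
  have hle : ∀ f ∈ K, Module.finrank F (LinearMap.range f) ≤ r := by
    intro f hf
    rcases eq_or_ne f 0 with rfl | h0
    · rw [LinearMap.range_zero, finrank_bot]
      exact r.zero_le
    · rw [← bilRank_eq_finrank_range, hK f hf h0]
  have hKu : ∀ u : V, d ≤ Module.finrank F (formsKilling K u) + r := by
    intro u
    have h1 := finrank_le_finrank_formsKilling_add K u ⊤ (fun _ _ => trivial)
    have h2 : Module.finrank F (⊤ : Submodule F (V →ₗ[F] F)) = n := by
      rw [finrank_top]
      exact Subspace.dual_finrank_eq
    have h3 : formsKilling K u ≠ ⊥ := by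
      intro h
      rw [h, finrank_bot] at h1
      omega
    obtain ⟨f, hf, hf0⟩ := Submodule.exists_mem_ne_zero_of_ne_bot h3
    rw [mem_formsKilling] at hf
    have hfr : Module.finrank F (LinearMap.range f) = r := by
      rw [← bilRank_eq_finrank_range, hK f hf.1 hf0]
    rw [← hfr]
    exact finrank_le_finrank_formsKilling_add K u _ fun g hg =>
      apply_mem_range_of_finrank_range_le hqr f g hfr
        (fun x => hle _ (K.add_mem (K.smul_mem x hf.1) hg)) hf.2
  obtain ⟨f, hf, hf0⟩ := Submodule.exists_mem_ne_zero_of_ne_bot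
    (p := K) (by rintro h; rw [hd, h, finrank_bot] at hlt; omega)
  have hrn : r ≤ n := by
    rw [← hK f hf hf0, hn, ← bilRank_add_finrank_ker f]; omega
  have hcount := sum_card_formsKilling_eq_sum_card_ker K
  set q : ℤ := (Nat.card F : ℤ) with hq
  have hq1 : 1 < q := by rw [hq]; exact_mod_cast (by omega : 1 < Nat.card F)
  have hR : ∑ f : LinearMap.BilinForm F V with f ≠ 0 ∧ f ∈ K,
      (q ^ Module.finrank F (LinearMap.ker f) - 1) = (q ^ d - 1) * (q ^ (n - r) - 1) := by
    rw [Finset.sum_congr rfl (g := fun _ => q ^ (n - r) - 1), Finset.sum_const, nsmul_eq_mul]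
    · rw [card_filter_mem_ne_zero]
    intro f hf
    rw [Finset.mem_filter] at hf
    have := bilRank_add_finrank_ker f
    rw [hK f hf.2.2 hf.2.1] at this
    rw [← hn] at this
    congr 2
    omega
  have hL : (q ^ n - 1) * (q ^ (d - r) - 1) ≤
      ∑ u : V with u ≠ 0, (q ^ Module.finrank F (formsKilling K u) - 1) := by
    have hc : ((Finset.univ.filter fun u : V => u ≠ 0).card : ℤ) = q ^ n - 1 := by
      have := card_filter_mem_ne_zero (F := F) (⊤ : Submodule F V)
      simpa using this
    rw [← hc, ← nsmul_eq_mul]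
    refine Finset.card_nsmul_le_sum _ _ _ fun u _ => ?_
    have := pow_le_pow_right₀ hq1.le (show d - r ≤ Module.finrank F (formsKilling K u) by
      have := hKu u; omega)
    linarith
  rw [hcount, hR] at hL
  obtain ⟨a, ha⟩ := Nat.exists_eq_add_of_le hrn
  obtain ⟨b, hb⟩ := Nat.exists_eq_add_of_le (hrn.trans hlt.le)
  have hab : q ^ a < q ^ b := pow_lt_pow_right₀ hq1 (by omega)
  have hqr1 : 1 < q ^ r := one_lt_pow₀ hq1 hr0.ne'
  rw [ha, hb, Nat.add_sub_cancel_left, Nat.add_sub_cancel_left, pow_add, pow_add] at hL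
  -- Expanded, `hL` says `(q^b - q^a)(q^r - 1) ≤ 0`.
  nlinarith [mul_pos (sub_pos.2 hab) (sub_pos.2 hqr1)]

end

/-- With `d = gcd m n`, taking gcds of squares gives `q^m - 1 ∣ (q^d - 1)^2`. If `m ≠ d` then `m ≥
2d`, and `q^(2d) - 1 > (q^d - 1)^2` is a contradiction. -/
theorem dvd_of_pow_sub_one_dvd_sq {q m n : ℕ} (hq : 1 < q) (hm : 0 < m)
    (h : q ^ m - 1 ∣ (q ^ n - 1) ^ 2) : m ∣ n := by
  set d := Nat.gcd m n with hd
  have hd0 : 0 < d := Nat.gcd_pos_of_pos_left _ hm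
  have h1 : q ^ m - 1 ∣ (q ^ d - 1) ^ 2 := by
    rw [hd, ← Nat.pow_sub_one_gcd_pow_sub_one, ← Nat.pow_gcd_pow]
    exact Nat.dvd_gcd (dvd_pow_self _ two_ne_zero) h
  have hqd : 1 < q ^ d := one_lt_pow₀ hq hd0.ne'
  obtain ⟨k, hk⟩ := Nat.gcd_dvd_left m n
  rw [← hd] at hk
  suffices k = 1 by
    rw [hk, this, mul_one]
    exact Nat.gcd_dvd_right m n
  by_contra hk1
  have hk2 : 2 ≤ k := by
    rcases k with _ | _ | k
    · omega
    · exact absurd rfl hk1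
    · omega
  have h2 : q ^ (d * 2) ≤ q ^ m :=
    Nat.pow_le_pow_right (by omega) (hk ▸ Nat.mul_le_mul_left d hk2)
  have h3 := Nat.le_of_dvd (pow_pos (by omega) 2) h1
  obtain ⟨s, hs⟩ := Nat.exists_eq_add_of_lt hqd
  rw [pow_mul, hs] at h2
  rw [hs, show 1 + s + 1 - 1 = s + 1 by omega] at h3
  have : (1 + s + 1) ^ 2 ≤ (s + 1) ^ 2 + 1 := by omega
  nlinarith

theorem mainTheorem2 {F V : Type*} [Field F] [Finite F]
    [AddCommGroup V] [Module F V] [FiniteDimensional F V]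
    (q n r : ℕ) (hq : Nat.card F = q) (hn : Module.finrank F V = n)
    (hr0 : 0 < r) (hrn : r < n) (hqr : r + 1 ≤ q)
    (M : Submodule F (LinearMap.BilinForm F V))
    (hM : Module.finrank F M = 2 * n)
    (hrank : ∀ f ∈ M, f ≠ 0 → bilRank f = r ∨ bilRank f = n) :
    (n - r) ∣ n ∧
      (Set.ncard {f : LinearMap.BilinForm F V | f ∈ M ∧ bilRank f = r} : ℚ) =
        ((q : ℚ) ^ n - 1) ^ 2 / ((q : ℚ) ^ (n - r) - 1) := by
  classical
  have : Finite V := Module.finite_of_finite F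
  have : Finite (LinearMap.BilinForm F V) := Module.finite_of_finite F
  have := Fintype.ofFinite V
  have := Fintype.ofFinite (LinearMap.BilinForm F V)
  have hq1 : 1 < q := by omega
  have hMu : ∀ u : V, u ≠ 0 → Module.finrank F (formsKilling M u) = n := by
    intro u hu
    apply le_antisymm
    · rw [← hn]
      refine finrank_le_of_constant_bilRank hr0 (hq ▸ hqr) _ fun f hf hf0 => ?_
      rw [mem_formsKilling] at hf
      refine (hrank f hf.1 hf0).resolve_right fun h => hu ?_
      have h1 := bilRank_add_finrank_ker f
      have h2 : LinearMap.ker f = ⊥ := Submodule.finrank_eq_zero.1 (by omega)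
      rw [← Submodule.mem_bot F, ← h2]
      exact hf.2
    · have h1 := finrank_le_finrank_formsKilling_add M u ⊤ (fun _ _ => trivial)
      have h2 : Module.finrank F (⊤ : Submodule F (V →ₗ[F] F)) = n := by
        rw [finrank_top, ← hn]
        exact Subspace.dual_finrank_eq
      omega
  set N := Set.ncard {f : LinearMap.BilinForm F V | f ∈ M ∧ bilRank f = r} with hN
  have hcount : ((q : ℤ) ^ n - 1) ^ 2 = N * ((q : ℤ) ^ (n - r) - 1) := by
    have h := sum_card_formsKilling_eq_sum_card_ker M
    rw [hq] at h
    have hc := card_filter_mem_ne_zero (F := F) (⊤ : Submodule F V)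
    simp only [Submodule.mem_top, and_true, finrank_top, hq, hn] at hc
    rw [Finset.sum_congr rfl (g := fun _ => (q : ℤ) ^ n - 1) (fun u hu => by
      rw [hMu u (Finset.mem_filter.1 hu).2]), Finset.sum_const, nsmul_eq_mul, hc, ← sq] at h
    rw [h, ← Finset.sum_filter_add_sum_filter_not _ fun f => bilRank f = r,
      Finset.sum_congr rfl (g := fun _ => (q : ℤ) ^ (n - r) - 1), Finset.sum_const, nsmul_eq_mul,
      Finset.sum_eq_zero, add_zero, hN, ← Set.ncard_coe_finset]
    · congr 3
      ext f
      simp only [Finset.coe_filter, Finset.mem_filter, Finset.mem_univ, true_and, Set.mem_ofPred_eq]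
      refine ⟨fun h => ⟨h.1.2, h.2⟩, fun h => ⟨⟨?_, h.1⟩, h.2⟩⟩
      rintro rfl
      have := h.2
      rw [bilRank_eq_finrank_range, LinearMap.range_zero, finrank_bot] at this
      omega
    · intro f hf
      simp only [Finset.mem_filter, Finset.mem_univ, true_and] at hf
      have h1 := bilRank_add_finrank_ker f
      have h2 := (hrank f hf.1.2 hf.1.1).resolve_left hf.2
      rw [show Module.finrank F (LinearMap.ker f) = 0 by omega, pow_zero, sub_self]
    · intro f hf
      simp only [Finset.mem_filter, Finset.mem_univ, true_and] at hf
      have h1 := bilRank_add_finrank_ker f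
      rw [show Module.finrank F (LinearMap.ker f) = n - r by omega]
  constructor
  · have hnr : 0 < n - r := by omega
    refine dvd_of_pow_sub_one_dvd_sq hq1 hnr ⟨N, ?_⟩
    zify [Nat.one_le_pow n q (by omega), Nat.one_le_pow (n - r) q (by omega)]
    rw [hcount, mul_comm]
  · have hpos : (1 : ℚ) < (q : ℚ) ^ (n - r) :=
      one_lt_pow₀ (by exact_mod_cast hq1) (by omega)
    rw [eq_div_iff (by linarith)]
    exact_mod_cast hcount.symm
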